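/- Let $\mathbb{H}^2$ be the hyperbolic plane in the Poincaré disc model, i.e. the unit disc with the metric $\left(\frac{2}{1-|z|^2}\right)^2(dx^2+dy^2)$, and let $|z|_{\mathbb{H}^2}$ denote the hyperbolic distance of $z$ from the origin. For $0<a<b$ let $\Omega(a,b)=\{z\in\mathbb{H}^2 : a\le |z|_{\mathbb{H}^2}\le b\}$. For a $C^2$ function $u$ put $$Q(u)=\mathrm{div}\left(\frac{\nabla u}{\sqrt{1+|\nabla u|^2}}\right),$$ where divergence, gradient and norm are those of $\mathbb{H}^2$ (so $Q(u)$ is twice the mean curvature of the graph of $u$ in $\mathbb{H}^2\times\mathbb{R}$). Let $0<h<\frac12$. For $\alpha>0$ put $$\rho^h(\alpha)=\mathrm{arccosh}\left(\frac{-2\alpha h+\sqrt{1-4h^2+\alpha^2}}{1-4h^2}\right),\qquad H^h_\alpha(\rho)=\int_{\rho^h(\alpha)}^{\rho}\frac{-\alpha+2h\cosh r}{\sqrt{\sinh^2 r-(-\alpha+2h\cosh r)^2}}\,dr\quad(\rho\ge\rho^h(\alpha)),$$ and $H^h_\alpha(z)=H^h_\alpha(|z|_{\mathbb{H}^2})$.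 **Theorem.** Let $0<h<\frac12$, $0<a<b$, and let $u$ be $C^2$ in the interior of $\Omega(a,b)$ and continuous on $\Omega(a,b)$, with $Q(u)=2h$ in the interior. Then there is exactly one $\beta\in(2h,+\infty)$ with $\rho^h(\beta)=a$, the integrals defining $H^h_\beta$ on $[a,b]$ converge, and, with $M=\max_{|z|_{\mathbb{H}^2}=b}u$, $$u(z)\le H^h_\beta(z)-H^h_\beta(b)+M\qquad\text{for all } z\in\Omega(a,b).$$ If moreover $a<\mathrm{arccosh}\left(\frac{1}{\sqrt{1-4h^2}}\right)$, then there is exactly one $\alpha\in(0,2h)$ with $\rho^h(\alpha)=a$, the integrals defining $H^h_\alpha$ on $[a,b]$ converge, and, with $m=\min_{|z|_{\mathbb{H}^2}=b}u$, $$H^h_\alpha(z)-H^h_\alpha(b)+m\le u(z)\qquad\text{for all } z\in\Omega(a,b).$$ -/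

import Mathlib

open MeasureTheory

noncomputable section

/-! The Poincare disc model: the hyperbolic plane is the unit disc `{z : ℂ | ‖z‖ < 1}` with the
conformal metric `(2 / (1 - |z|²))² (dx² + dy²)`. Functions on subsets of the hyperbolic plane are
functions `ℂ → ℝ` whose values outside the set in question are irrelevant, and a tangent vector
`X ∂x + Y ∂y` is the complex number `X + i Y`. -/

/-- The conformal factor of the hyperbolic metric. -/
def hypFactor (z : ℂ) : ℝ := 2 / (1 - ‖z‖ ^ 2)

/-- The hyperbolic distance between two points of the unit disc. -/
def hypDist (z w : ℂ) : ℝ :=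
  2 * Real.arsinh (‖z - w‖ / √((1 - ‖z‖ ^ 2) * (1 - ‖w‖ ^ 2)))

/-- The hyperbolic distance of `z` from the origin. -/
def hypRadius (z : ℂ) : ℝ := hypDist 0 z

/-- The hyperbolic length of the tangent vector `v` at the point `z`. -/
def hypTangentNorm (z v : ℂ) : ℝ := hypFactor z * ‖v‖

/-- The gradient of `u` with respect to the hyperbolic metric: the components of the inverse
metric tensor are `(hypFactor z)⁻² δⁱʲ`. -/
def hypGradient (u : ℂ → ℝ) (z : ℂ) : ℂ :=
  ⟨(hypFactor z ^ 2)⁻¹ * fderiv ℝ u z 1, (hypFactor z ^ 2)⁻¹ * fderiv ℝ u z Complex.I⟩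

/-- The divergence of the vector field `X` with respect to the hyperbolic metric, that is
`(√g)⁻¹ ∂ᵢ (√g Xⁱ)` with `√g = (hypFactor z)²`. -/
def hypDivergence (X : ℂ → ℂ) (z : ℂ) : ℝ :=
  (hypFactor z ^ 2)⁻¹ *
    (fderiv ℝ (fun w => hypFactor w ^ 2 * (X w).re) z 1 +
      fderiv ℝ (fun w => hypFactor w ^ 2 * (X w).im) z Complex.I)

/-- The mean curvature operator `Q u = div (∇u / √(1 + |∇u|²))`; the graph of `u` has mean
curvature `Q u / 2` in the product of the hyperbolic plane with the real line. -/
def meanCurvatureOp (u : ℂ → ℝ) : ℂ → ℝ :=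
  hypDivergence fun w =>
    ((√(1 + hypTangentNorm w (hypGradient u w) ^ 2))⁻¹ : ℝ) • hypGradient u w

/-- The closed circular annulus of hyperbolic radii `a` and `b` about the origin. -/
def hypAnnulus (a b : ℝ) : Set ℂ := {z | ‖z‖ < 1 ∧ a ≤ hypRadius z ∧ hypRadius z ≤ b}

/-- The circle of hyperbolic radius `r` about the origin. -/
def hypCircle (r : ℝ) : Set ℂ := {z | ‖z‖ < 1 ∧ hypRadius z = r}

/-- The radius `ρ^h(α)` of the boundary circle of the rotational surface of parameter `α`,
for `0 < h < 1/2`. -/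
def rotRadius (h α : ℝ) : ℝ :=
  Real.arcosh ((-2 * α * h + √(1 - 4 * h ^ 2 + α ^ 2)) / (1 - 4 * h ^ 2))

/-- The slope `u^h_α` of the rotational surface of parameter `α`. -/
def rotSlope (h α ρ : ℝ) : ℝ :=
  (-α + 2 * h * Real.cosh ρ) /
    √(Real.sinh ρ ^ 2 - (-α + 2 * h * Real.cosh ρ) ^ 2)

/-- The height `H^h_α` of the rotational surface of parameter `α`, as a function of the hyperbolic
distance from the origin. -/
def rotHeight (h α ρ : ℝ) : ℝ := ∫ r in (rotRadius h α)..ρ, rotSlope h α r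

end

open Filter Topology Set

noncomputable section

/-! ### The mean curvature operator in Euclidean coordinates -/

/-! The bounds come from comparing `u` with rotational solutions that become vertical on the inner
circle. For a radial `w`, the equation `Q w = c` integrates once: the flux `sinh ρ · w' / √(1 +
w'²)` equals `c cosh ρ - k`. With `k = c cosh a + sinh a` it equals `-sinh a` at `ρ = a`, so the
slope is `-∞` there. When `|c| < 1` the slope blows up only like `(ρ - a)^(-1/2)`, and the barrier
stays continuous up to the inner circle.

A maximum of `u - w` on the annulus has three possible places. On the outer circle it is controlled
by `M`. On the inner circle it is impossible where `u` is differentiable, because `w` drops faster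
than any linear function (`not_isMaxOn_sub_barrier_of_inner`). At an interior point the gradients
agree and the Hessians are ordered, so `Q u ≤ Q w` (`meanCurvatureOp_le_of_isLocalMax_sub`).

To exclude the interior case without a strong maximum principle, and to have `u` differentiable on
the barrier's inner circle, the barrier is perturbed to curvature `c - ε` and inner radius `a + ε`
(`le_barrier_add_of_lt`). Letting `ε → 0` gives `le_barrier_add`.

The upper bound is the case `c = 2h`. The lower bound is the case `c = -2h` applied to `-u`. The two
parameters are the roots `2h cosh a ± sinh a` of `rotRadius h α = a` (`rotRadius_eq_iff`). -/

/-- The inverse square of the conformal factor. -/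
def invFactorSq (z : ℂ) : ℝ := ((1 - ‖z‖ ^ 2) / 2) ^ 2

lemma one_sub_norm_sq_pos {z : ℂ} (hz : ‖z‖ < 1) : 0 < 1 - ‖z‖ ^ 2 := by
  nlinarith [norm_nonneg z]

lemma inv_hypFactor_sq (z : ℂ) : (hypFactor z ^ 2)⁻¹ = invFactorSq z := by
  rw [hypFactor, invFactorSq, ← inv_pow, inv_div]

lemma invFactorSq_pos {z : ℂ} (hz : ‖z‖ < 1) : 0 < invFactorSq z := by
  have := one_sub_norm_sq_pos hz
  unfold invFactorSq; positivity

lemma differentiable_invFactorSq : Differentiable ℝ invFactorSq := by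
  unfold invFactorSq
  have : Differentiable ℝ fun z : ℂ => ‖z‖ ^ 2 := fun z => differentiableAt_id.norm_sq ℝ
  fun_prop

lemma eventually_norm_lt_one {z : ℂ} (hz : ‖z‖ < 1) : ∀ᶠ w in 𝓝 z, ‖w‖ < 1 :=
  continuous_norm.continuousAt.eventually_lt continuousAt_const hz

/-- The density `√(1 + |∇u|²)` of the area of the graph. -/
def areaDensity (u : ℂ → ℝ) (w : ℂ) : ℝ :=
  √(1 + invFactorSq w * (fderiv ℝ u w 1 ^ 2 + fderiv ℝ u w Complex.I ^ 2))

lemma hypTangentNorm_hypGradient_sq (u : ℂ → ℝ) {w : ℂ} (hw : ‖w‖ < 1) :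
    hypTangentNorm w (hypGradient u w) ^ 2 =
      invFactorSq w * (fderiv ℝ u w 1 ^ 2 + fderiv ℝ u w Complex.I ^ 2) := by
  have h0 := invFactorSq_pos hw
  have h1 : hypFactor w ^ 2 = (invFactorSq w)⁻¹ := by rw [← inv_hypFactor_sq, inv_inv]
  rw [hypTangentNorm, mul_pow, h1, ← Complex.normSq_eq_norm_sq, Complex.normSq_apply, hypGradient,
    inv_hypFactor_sq]
  field_simp

/-- In dimension two the area factor cancels the inverse metric in the gradient, leaving a Euclidean
divergence; the metric survives only in the prefactor and in the density. -/
lemma meanCurvatureOp_eq (u : ℂ → ℝ) {z : ℂ} (hz : ‖z‖ < 1) :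
    meanCurvatureOp u z = invFactorSq z *
      (fderiv ℝ (fun w => fderiv ℝ u w 1 / areaDensity u w) z 1 +
        fderiv ℝ (fun w => fderiv ℝ u w Complex.I / areaDensity u w) z Complex.I) := by
  rw [meanCurvatureOp, hypDivergence, inv_hypFactor_sq]
  congr 3
  all_goals
    refine Filter.EventuallyEq.fderiv_eq ?_
    filter_upwards [eventually_norm_lt_one hz] with w hw
    have h0 := invFactorSq_pos hw
    have h1 : hypFactor w ^ 2 = (invFactorSq w)⁻¹ := by rw [← inv_hypFactor_sq, inv_inv]
    rw [hypTangentNorm_hypGradient_sq u hw, h1, areaDensity]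
    simp only [hypGradient, inv_hypFactor_sq, Complex.smul_re, Complex.smul_im, smul_eq_mul]
    field_simp

lemma fderiv_div_sqrt {m p q f : ℂ → ℝ} {z : ℂ} (hm : DifferentiableAt ℝ m z)
    (hp : DifferentiableAt ℝ p z) (hq : DifferentiableAt ℝ q z) (hf : DifferentiableAt ℝ f z)
    (h0 : 0 ≤ m z) (e : ℂ) :
    fderiv ℝ (fun w => f w / √(1 + m w * (p w ^ 2 + q w ^ 2))) z e =
      (fderiv ℝ f z e * (1 + m z * (p z ^ 2 + q z ^ 2)) -
        f z * (fderiv ℝ m z e * (p z ^ 2 + q z ^ 2) / 2 +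
          m z * (p z * fderiv ℝ p z e + q z * fderiv ℝ q z e))) /
        √(1 + m z * (p z ^ 2 + q z ^ 2)) ^ 3 := by
  have hpos : 0 < 1 + m z * (p z ^ 2 + q z ^ 2) := by positivity
  have hD := (hf.hasFDerivAt).mul ((hasDerivAt_inv (Real.sqrt_pos.2 hpos).ne').comp_hasFDerivAt z
    ((((hm.hasFDerivAt).mul ((hp.hasFDerivAt.pow 2).add (hq.hasFDerivAt.pow 2))).const_add
      1).sqrt hpos.ne'))
  have hD' : HasFDerivAt (fun w => f w / √(1 + m w * (p w ^ 2 + q w ^ 2))) _ z := hD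
  rw [hD'.fderiv]
  have hs := Real.sqrt_pos.2 hpos
  have hs2 := Real.sq_sqrt hpos.le
  simp
  generalize √(1 + m z * (p z ^ 2 + q z ^ 2)) = s at *
  rw [← hs2]
  field_simp
  ring

/-- A positive second derivative would make `x` a local minimum as well, so `f` would be locally
constant and its second derivative zero. -/
lemma deriv_deriv_nonpos_of_isLocalMax {f : ℝ → ℝ} {x : ℝ} (hf : IsLocalMax f x)
    (hc : ContinuousAt f x) : deriv (deriv f) x ≤ 0 := by
  by_contra! h
  have hmin := isLocalMin_of_deriv_deriv_pos h hf.deriv_eq_zero hc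
  have hconst : f =ᶠ[𝓝 x] fun _ => f x := by
    filter_upwards [hf, hmin] with y h1 h2 using le_antisymm h1 h2
  have h2 : deriv f =ᶠ[𝓝 x] fun _ => 0 := by
    filter_upwards [hconst.deriv] with y hy
    simpa using hy
  rw [h2.deriv_eq] at h
  simp at h

lemma fderiv_fderiv_nonpos_of_isLocalMax {v : ℂ → ℝ} {z : ℂ} (hv : ContDiffAt ℝ 2 v z)
    (hmax : IsLocalMax v z) (e : ℂ) : fderiv ℝ (fderiv ℝ v) z e e ≤ 0 := by
  set ℓ : ℝ → ℂ := fun t => z + t • e with hℓ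
  have hℓd : ∀ t, HasDerivAt ℓ e t := fun t => by
    have := ((hasDerivAt_id t).smul_const e).const_add z
    rwa [one_smul] at this
  have hℓ0 : ℓ 0 = z := by simp [hℓ]
  have hℓc : ContinuousAt ℓ 0 := (hℓd 0).continuousAt
  have hdiff : ∀ᶠ w in 𝓝 (ℓ 0), DifferentiableAt ℝ v w := by
    rw [hℓ0]
    filter_upwards [hv.eventually (by simp)] with w hw using hw.differentiableAt (by simp)
  have h1 : deriv (v ∘ ℓ) =ᶠ[𝓝 0] fun t => fderiv ℝ v (ℓ t) e := by
    filter_upwards [hℓc.eventually hdiff] with t ht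
    exact (ht.hasFDerivAt.comp_hasDerivAt t (hℓd t)).deriv
  have h2 : DifferentiableAt ℝ (fderiv ℝ v) (ℓ 0) := by
    rw [hℓ0]; exact (hv.fderiv_right (m := 1) (by norm_num)).differentiableAt (by simp)
  have h3 : HasDerivAt (fun t => fderiv ℝ v (ℓ t) e) (fderiv ℝ (fderiv ℝ v) z e e) 0 := by
    have := (h2.hasFDerivAt.comp_hasDerivAt 0 (hℓd 0)).clm_apply (hasDerivAt_const 0 e)
    simpa [hℓ0] using this
  have h4 : deriv (deriv (v ∘ ℓ)) 0 = fderiv ℝ (fderiv ℝ v) z e e := by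
    rw [h1.deriv_eq, h3.deriv]
  rw [← h4]
  refine deriv_deriv_nonpos_of_isLocalMax ?_ ?_
  · have : IsLocalMax v (ℓ 0) := by rwa [hℓ0]
    exact this.comp_continuous hℓc
  · exact ContinuousAt.comp (by rw [hℓ0]; exact hv.continuousAt) hℓc

lemma fderiv_fderiv_apply {v : ℂ → ℝ} {z : ℂ} (hv : ContDiffAt ℝ 2 v z) (e d : ℂ) :
    fderiv ℝ (fun w => fderiv ℝ v w e) z d = fderiv ℝ (fderiv ℝ v) z d e := by
  have h2 : DifferentiableAt ℝ (fderiv ℝ v) z :=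
    (hv.fderiv_right (m := 1) (by norm_num)).differentiableAt (by simp)
  have := h2.hasFDerivAt.clm_apply (hasFDerivAt_const e z)
  rw [this.fderiv]; simp

/-- The comparison at a touching point. -/
lemma meanCurvatureOp_le_of_isLocalMax_sub {u w : ℂ → ℝ} {z : ℂ} (hz : ‖z‖ < 1)
    (hu : ContDiffAt ℝ 2 u z) (hw : ContDiffAt ℝ 2 w z) (hmax : IsLocalMax (u - w) z) :
    meanCurvatureOp u z ≤ meanCurvatureOp w z := by
  have hv : ContDiffAt ℝ 2 (u - w) z := hu.sub hw
  have hud := hu.differentiableAt (by simp)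
  have hwd := hw.differentiableAt (by simp)
  have hu2 : DifferentiableAt ℝ (fderiv ℝ u) z :=
    (hu.fderiv_right (m := 1) (by norm_num)).differentiableAt (by simp)
  have hw2 : DifferentiableAt ℝ (fderiv ℝ w) z :=
    (hw.fderiv_right (m := 1) (by norm_num)).differentiableAt (by simp)
  have hgrad : fderiv ℝ u z = fderiv ℝ w z := by
    have := hmax.fderiv_eq_zero
    rw [fderiv_sub hud hwd] at this
    exact sub_eq_zero.1 this
  have hD2 : fderiv ℝ (fderiv ℝ (u - w)) z = fderiv ℝ (fderiv ℝ u) z - fderiv ℝ (fderiv ℝ w) z := by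
    rw [← fderiv_sub hu2 hw2]
    refine Filter.EventuallyEq.fderiv_eq ?_
    filter_upwards [hu.eventually (by simp), hw.eventually (by simp)] with y h1 h2
    exact fderiv_sub (h1.differentiableAt (by simp)) (h2.differentiableAt (by simp))
  have h11 := fderiv_fderiv_nonpos_of_isLocalMax hv hmax 1
  have h22 := fderiv_fderiv_nonpos_of_isLocalMax hv hmax Complex.I
  have hm0 := invFactorSq_pos hz
  have hc : ∀ {f : ℂ → ℝ}, ContDiffAt ℝ 2 f z → ∀ e : ℂ,
      DifferentiableAt ℝ (fun w => fderiv ℝ f w e) z := fun hf e =>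
    (((hf.fderiv_right (m := 1) (by norm_num)).differentiableAt (by simp)).clm_apply
      (differentiableAt_const e))
  rw [meanCurvatureOp_eq u hz, meanCurvatureOp_eq w hz]
  refine mul_le_mul_of_nonneg_left ?_ hm0.le
  simp only [areaDensity]
  rw [fderiv_div_sqrt differentiable_invFactorSq.differentiableAt (hc hu _) (hc hu _) (hc hu _)
      hm0.le,
    fderiv_div_sqrt differentiable_invFactorSq.differentiableAt (hc hu _) (hc hu _) (hc hu _)
      hm0.le,
    fderiv_div_sqrt differentiable_invFactorSq.differentiableAt (hc hw _) (hc hw _) (hc hw _)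
      hm0.le,
    fderiv_div_sqrt differentiable_invFactorSq.differentiableAt (hc hw _) (hc hw _) (hc hw _)
      hm0.le]
  simp only [fderiv_fderiv_apply hu, fderiv_fderiv_apply hw, hgrad]
  set p := fderiv ℝ w z 1
  set q := fderiv ℝ w z Complex.I
  -- The second-order part of the numerator is the trace of the Hessian plus `m` times the Hessian
  -- in the direction `(q, -p)` orthogonal to the gradient. The remaining terms depend only on the
  -- common gradient and cancel.
  have hpq := fderiv_fderiv_nonpos_of_isLocalMax hv hmax (q • (1 : ℂ) - p • Complex.I)
  simp only [hD2, map_sub, map_smul, sub_apply, smul_apply,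
    smul_eq_mul] at hpq h11 h22
  set m := invFactorSq z
  have hpos : 0 < 1 + m * (p ^ 2 + q ^ 2) := by positivity
  have hs := Real.sqrt_pos.2 hpos
  rw [← add_div, ← add_div]
  refine div_le_div_of_nonneg_right ?_ (by positivity)
  have := mul_nonpos_of_nonneg_of_nonpos hm0.le hpq
  linear_combination h11 + h22 + this

/-! ### The distance from the origin -/

lemma norm_mem_Ioo {z : ℂ} (hz : ‖z‖ < 1) : ‖z‖ ∈ Ioo (-1 : ℝ) 1 :=
  ⟨by linarith [norm_nonneg z], hz⟩

lemma hypRadius_eq_arsinh (z : ℂ) : hypRadius z = 2 * Real.arsinh (‖z‖ / √(1 - ‖z‖ ^ 2)) := by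
  simp [hypRadius, hypDist]

lemma hypRadius_eq_artanh {z : ℂ} (hz : ‖z‖ < 1) : hypRadius z = 2 * Real.artanh ‖z‖ := by
  rw [hypRadius_eq_arsinh, ← Real.sinh_artanh (norm_mem_Ioo hz), Real.arsinh_sinh]

lemma cosh_hypRadius {z : ℂ} (hz : ‖z‖ < 1) :
    Real.cosh (hypRadius z) = (1 + ‖z‖ ^ 2) / (1 - ‖z‖ ^ 2) := by
  have h0 := one_sub_norm_sq_pos hz
  rw [hypRadius_eq_artanh hz, Real.cosh_two_mul, Real.sinh_artanh (norm_mem_Ioo hz),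
    Real.cosh_artanh (norm_mem_Ioo hz), div_pow, div_pow, Real.sq_sqrt h0.le]
  field_simp

lemma sinh_hypRadius {z : ℂ} (hz : ‖z‖ < 1) :
    Real.sinh (hypRadius z) = 2 * ‖z‖ / (1 - ‖z‖ ^ 2) := by
  have h0 := one_sub_norm_sq_pos hz
  have h1 := Real.sqrt_pos.2 h0
  rw [hypRadius_eq_artanh hz, Real.sinh_two_mul, Real.sinh_artanh (norm_mem_Ioo hz),
    Real.cosh_artanh (norm_mem_Ioo hz)]
  nth_rewrite 3 [← Real.sq_sqrt h0.le]
  field_simp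

lemma tanh_mem_Ioo (r : ℝ) : Real.tanh r ∈ Ioo (-1 : ℝ) 1 :=
  ⟨Real.neg_one_lt_tanh r, Real.tanh_lt_one r⟩

lemma hypRadius_le_iff {z : ℂ} (hz : ‖z‖ < 1) (r : ℝ) :
    hypRadius z ≤ r ↔ ‖z‖ ≤ Real.tanh (r / 2) := by
  rw [← Real.artanh_le_artanh_iff (norm_mem_Ioo hz) (tanh_mem_Ioo _), Real.artanh_tanh,
    hypRadius_eq_artanh hz]
  constructor <;> intro h <;> linarith

lemma le_hypRadius_iff {z : ℂ} (hz : ‖z‖ < 1) (r : ℝ) :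
    r ≤ hypRadius z ↔ Real.tanh (r / 2) ≤ ‖z‖ := by
  rw [← Real.artanh_le_artanh_iff (tanh_mem_Ioo _) (norm_mem_Ioo hz), Real.artanh_tanh,
    hypRadius_eq_artanh hz]
  constructor <;> intro h <;> linarith

lemma hypAnnulus_eq (a b : ℝ) :
    hypAnnulus a b = {z | Real.tanh (a / 2) ≤ ‖z‖ ∧ ‖z‖ ≤ Real.tanh (b / 2)} := by
  ext z
  simp only [hypAnnulus, mem_ofPred_eq]
  constructor
  · rintro ⟨h, h1, h2⟩
    exact ⟨(le_hypRadius_iff h a).1 h1, (hypRadius_le_iff h b).1 h2⟩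
  · rintro ⟨h1, h2⟩
    have h := h2.trans_lt (Real.tanh_lt_one _)
    exact ⟨h, (le_hypRadius_iff h a).2 h1, (hypRadius_le_iff h b).2 h2⟩

lemma isCompact_hypAnnulus (a b : ℝ) : IsCompact (hypAnnulus a b) := by
  rw [hypAnnulus_eq]
  refine Metric.isCompact_of_isClosed_isBounded ?_ ?_
  · exact (isClosed_le continuous_const continuous_norm).inter
      (isClosed_le continuous_norm continuous_const)
  · exact (Metric.isBounded_closedBall (x := (0 : ℂ)) (r := Real.tanh (b / 2))).subset
      fun z hz => by simpa using hz.2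

lemma hypCircle_eq (r : ℝ) : hypCircle r = hypAnnulus r r := by
  ext z
  simp only [hypCircle, hypAnnulus, mem_ofPred_eq]
  constructor
  · rintro ⟨h, rfl⟩; exact ⟨h, le_rfl, le_rfl⟩
  · rintro ⟨h, h1, h2⟩; exact ⟨h, le_antisymm h2 h1⟩

lemma tanh_nonneg {r : ℝ} (hr : 0 ≤ r) : 0 ≤ Real.tanh r := by
  rw [Real.tanh_eq_sinh_div_cosh]
  exact div_nonneg (Real.sinh_nonneg_iff.2 hr) (Real.cosh_pos r).le

/-- The point at distance `r` from the origin on the ray in the direction of `v`. -/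
def radialPoint (v : ℂ) (r : ℝ) : ℂ := (Real.tanh (r / 2) / ‖v‖) • v

lemma norm_radialPoint {v : ℂ} (hv : v ≠ 0) {r : ℝ} (hr : 0 ≤ r) :
    ‖radialPoint v r‖ = Real.tanh (r / 2) := by
  have h := norm_pos_iff.2 hv
  rw [radialPoint, norm_smul, Real.norm_of_nonneg (div_nonneg (tanh_nonneg (by linarith)) h.le)]
  field_simp

lemma norm_radialPoint_lt_one {v : ℂ} (hv : v ≠ 0) {r : ℝ} (hr : 0 ≤ r) :
    ‖radialPoint v r‖ < 1 := by
  rw [norm_radialPoint hv hr]; exact Real.tanh_lt_one _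

lemma hypRadius_radialPoint {v : ℂ} (hv : v ≠ 0) {r : ℝ} (hr : 0 ≤ r) :
    hypRadius (radialPoint v r) = r := by
  rw [hypRadius_eq_artanh (norm_radialPoint_lt_one hv hr), norm_radialPoint hv hr,
    Real.artanh_tanh]
  ring

lemma radialPoint_hypRadius {z : ℂ} (hz0 : z ≠ 0) (hz : ‖z‖ < 1) :
    radialPoint z (hypRadius z) = z := by
  have h := norm_pos_iff.2 hz0
  rw [radialPoint, hypRadius_eq_artanh hz, mul_div_cancel_left₀ _ (two_ne_zero),
    Real.tanh_artanh (norm_mem_Ioo hz), div_self h.ne', one_smul]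

lemma differentiable_radialPoint (v : ℂ) : Differentiable ℝ (radialPoint v) := by
  have : Differentiable ℝ Real.tanh := by
    have h : Real.tanh = fun x => Real.sinh x / Real.cosh x :=
      funext Real.tanh_eq_sinh_div_cosh
    rw [h]
    exact Real.differentiable_sinh.div Real.differentiable_cosh fun x => (Real.cosh_pos x).ne'
  unfold radialPoint
  have h2 : Differentiable ℝ fun r : ℝ => Real.tanh (r / 2) :=
    this.comp (differentiable_id.div_const 2)
  exact (h2.div_const _).smul_const v

lemma hypCircle_nonempty {r : ℝ} (hr : 0 ≤ r) : (hypCircle r).Nonempty :=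
  ⟨radialPoint 1 r, norm_radialPoint_lt_one one_ne_zero hr, hypRadius_radialPoint one_ne_zero hr⟩

lemma hypRadius_zero : hypRadius 0 = 0 := by simp [hypRadius_eq_arsinh]

lemma ne_zero_of_hypRadius_pos {z : ℂ} (h : 0 < hypRadius z) : z ≠ 0 := by
  rintro rfl; simp [hypRadius_zero] at h

lemma continuousAt_hypRadius {z : ℂ} (hz : ‖z‖ < 1) : ContinuousAt hypRadius z := by
  have h0 := one_sub_norm_sq_pos hz
  have : hypRadius = fun z => 2 * Real.arsinh (‖z‖ / √(1 - ‖z‖ ^ 2)) := funext hypRadius_eq_arsinh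
  rw [this]
  refine continuousAt_const.mul (Real.continuous_arsinh.continuousAt.comp ?_)
  exact continuous_norm.continuousAt.div (by fun_prop) (Real.sqrt_pos.2 h0).ne'

lemma contDiffAt_hypRadius {z : ℂ} (hz0 : z ≠ 0) (hz : ‖z‖ < 1) {n : WithTop ℕ∞} :
    ContDiffAt ℝ n hypRadius z := by
  have h0 := one_sub_norm_sq_pos hz
  have : hypRadius = fun z => 2 * Real.arsinh (‖z‖ / √(1 - ‖z‖ ^ 2)) := funext hypRadius_eq_arsinh
  rw [this]
  refine contDiffAt_const.mul (Real.contDiff_arsinh.contDiffAt.comp z ?_)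
  have h1 : ContDiffAt ℝ n (fun z : ℂ => 1 - ‖z‖ ^ 2) z :=
    contDiffAt_const.sub (contDiffAt_id.norm_sq ℝ)
  exact (contDiffAt_norm ℝ hz0).div (h1.sqrt h0.ne') (Real.sqrt_pos.2 h0).ne'

lemma hypAnnulus_subset_interior {a b : ℝ} :
    {z : ℂ | ‖z‖ < 1 ∧ a < hypRadius z ∧ hypRadius z < b} ⊆ interior (hypAnnulus a b) := by
  rintro z ⟨hz, h1, h2⟩
  rw [mem_interior_iff_mem_nhds]
  filter_upwards [eventually_norm_lt_one hz,
    (continuousAt_hypRadius hz).eventually (lt_mem_nhds h1),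
    (continuousAt_hypRadius hz).eventually (gt_mem_nhds h2)] with w hw h3 h4
  exact ⟨hw, h3.le, h4.le⟩

lemma hasFDerivAt_norm_sq (z : ℂ) :
    HasFDerivAt (fun w : ℂ => ‖w‖ ^ 2) (2 • (innerSL ℝ z)) z :=
  (hasStrictFDerivAt_norm_sq z).hasFDerivAt

/-- Obtained by differentiating `cosh (hypRadius z) * (1 - ‖z‖²) = 1 + ‖z‖²`. -/
lemma fderiv_hypRadius {z : ℂ} (hz0 : z ≠ 0) (hz : ‖z‖ < 1) (e : ℂ) :
    fderiv ℝ hypRadius z e * (1 - ‖z‖ ^ 2) ^ 2 * Real.sinh (hypRadius z) = 4 * inner ℝ z e := by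
  have h0 := one_sub_norm_sq_pos hz
  have hd : DifferentiableAt ℝ hypRadius z :=
    (contDiffAt_hypRadius hz0 hz (n := 1)).differentiableAt (by simp)
  have h1 : HasFDerivAt (fun w => Real.cosh (hypRadius w) * (1 - ‖w‖ ^ 2)) _ z :=
    (((Real.hasDerivAt_cosh _).comp_hasFDerivAt z hd.hasFDerivAt)).mul
      ((hasFDerivAt_norm_sq z).const_sub 1)
  have h2 : HasFDerivAt (fun w => Real.cosh (hypRadius w) * (1 - ‖w‖ ^ 2)) _ z :=
    ((hasFDerivAt_norm_sq z).const_add 1).congr_of_eventuallyEq (by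
      filter_upwards [eventually_norm_lt_one hz] with w hw
      have := one_sub_norm_sq_pos hw
      rw [cosh_hypRadius hw]; field_simp)
  have h3 := congrArg (fun T : ℂ →L[ℝ] ℝ => T e) (h1.unique h2)
  simp [cosh_hypRadius hz] at h3
  field_simp at h3
  simp only [Complex.inner] at h3 ⊢
  simp at h3 ⊢
  linear_combination h3

/-! ### Rotationally symmetric functions -/

/-- The slope `F / √(S² - F²)` is the one whose flux is `F`, since one plus its square is `S² / (S²
- F²)`. -/
lemma areaDensity_aux {F S : ℝ} (h : |F| < S) :
    F / √(S ^ 2 - F ^ 2) / √(1 + (F / √(S ^ 2 - F ^ 2)) ^ 2) = F / S := by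
  have hS : 0 < S := (abs_nonneg F).trans_lt h
  have hpos : 0 < S ^ 2 - F ^ 2 := by
    have := sq_lt_sq' (by linarith [neg_abs_le F]) ((le_abs_self F).trans_lt h)
    linarith
  have hs := Real.sqrt_pos.2 hpos
  have h1 : 1 + (F / √(S ^ 2 - F ^ 2)) ^ 2 = (S / √(S ^ 2 - F ^ 2)) ^ 2 := by
    rw [div_pow, div_pow, Real.sq_sqrt hpos.le]; field_simp; ring
  rw [h1, Real.sqrt_sq (by positivity)]
  field_simp

lemma fderiv_div_areaDensity_radial {G : ℝ → ℝ} {z : ℂ} (hz0 : z ≠ 0) (hz : ‖z‖ < 1) {F : ℝ}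
    (hF : |F| < Real.sinh (hypRadius z))
    (hG : HasDerivAt G (F / √(Real.sinh (hypRadius z) ^ 2 - F ^ 2)) (hypRadius z)) (e : ℂ) :
    fderiv ℝ (fun y => G (hypRadius y)) z e / areaDensity (fun y => G (hypRadius y)) z =
      F * inner ℝ z e / ‖z‖ ^ 2 := by
  have h0 := one_sub_norm_sq_pos hz
  have hn := norm_pos_iff.2 hz0
  have hd : DifferentiableAt ℝ hypRadius z :=
    (contDiffAt_hypRadius hz0 hz (n := 1)).differentiableAt (by simp)
  have hS := sinh_hypRadius hz
  have hSpos : 0 < Real.sinh (hypRadius z) := (abs_nonneg F).trans_lt hF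
  have hder : ∀ e, fderiv ℝ hypRadius z e = 2 * inner ℝ z e / (‖z‖ * (1 - ‖z‖ ^ 2)) := by
    intro e
    have := fderiv_hypRadius hz0 hz e
    rw [hS] at this
    field_simp at this ⊢
    linear_combination this / 2
  set g := F / √(Real.sinh (hypRadius z) ^ 2 - F ^ 2) with hg
  have hw : ∀ e, fderiv ℝ (fun y => G (hypRadius y)) z e = g * fderiv ℝ hypRadius z e := by
    intro e
    have := (hG.comp_hasFDerivAt z hd.hasFDerivAt).fderiv
    rw [show (fun y => G (hypRadius y)) = G ∘ hypRadius from rfl, this]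
    simp
  have hsq : ‖z‖ ^ 2 = z.re ^ 2 + z.im ^ 2 := by
    rw [← Complex.normSq_eq_norm_sq, Complex.normSq_apply]; ring
  have hA : areaDensity (fun y => G (hypRadius y)) z = √(1 + g ^ 2) := by
    rw [areaDensity, hw, hw, hder, hder, invFactorSq]
    congr 2
    simp only [Complex.inner]
    simp
    field_simp
    linear_combination -g ^ 2 * hsq
  have haux := areaDensity_aux hF
  rw [← hg] at haux
  rw [hA, hw, mul_comm, mul_div_assoc, haux, hder, hS]
  field_simp

/-- The field to differentiate is `F(ρ) z / ‖z‖²`. As `z / ‖z‖²` is divergence free in the plane,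
only the derivative of `F` contributes and the constant `k` is free. -/
lemma meanCurvatureOp_radial {G : ℝ → ℝ} {z : ℂ} (hz0 : z ≠ 0) (hz : ‖z‖ < 1) {c k : ℝ}
    (hG : ∀ᶠ r in 𝓝 (hypRadius z), |c * Real.cosh r - k| < Real.sinh r ∧
      HasDerivAt G ((c * Real.cosh r - k) / √(Real.sinh r ^ 2 - (c * Real.cosh r - k) ^ 2)) r) :
    meanCurvatureOp (fun y => G (hypRadius y)) z = c := by
  have h0 := one_sub_norm_sq_pos hz
  have hn := norm_pos_iff.2 hz0
  have hflux : ∀ e, (fun y => fderiv ℝ (fun y => G (hypRadius y)) y e /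
      areaDensity (fun y => G (hypRadius y)) y) =ᶠ[𝓝 z]
      fun y => (c * ((1 + ‖y‖ ^ 2) / (1 - ‖y‖ ^ 2)) - k) * inner ℝ y e / ‖y‖ ^ 2 := by
    intro e
    filter_upwards [eventually_norm_lt_one hz, eventually_ne_nhds hz0,
      (continuousAt_hypRadius hz).eventually hG] with y hy hy0 hGy
    rw [fderiv_div_areaDensity_radial hy0 hy hGy.1 hGy.2, cosh_hypRadius hy]
  have hder : ∀ e, fderiv ℝ (fun y : ℂ => (c * ((1 + ‖y‖ ^ 2) / (1 - ‖y‖ ^ 2)) - k) *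
      inner ℝ y e / ‖y‖ ^ 2) z e = 4 * c * inner ℝ z e ^ 2 / ((1 - ‖z‖ ^ 2) ^ 2 * ‖z‖ ^ 2) +
      (c * ((1 + ‖z‖ ^ 2) / (1 - ‖z‖ ^ 2)) - k) *
        (‖e‖ ^ 2 / ‖z‖ ^ 2 - 2 * inner ℝ z e ^ 2 / ‖z‖ ^ 4) := by
    intro e
    have h1 : HasDerivAt (fun s : ℝ => (c * ((1 + s) / (1 - s)) - k) / s)
        (c * (2 / (1 - ‖z‖ ^ 2) ^ 2) / ‖z‖ ^ 2 -
          (c * ((1 + ‖z‖ ^ 2) / (1 - ‖z‖ ^ 2)) - k) / ‖z‖ ^ 4) (‖z‖ ^ 2) := by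
      have := (((((hasDerivAt_id (‖z‖ ^ 2)).const_add 1).div
        ((hasDerivAt_id (‖z‖ ^ 2)).const_sub 1) h0.ne').const_mul c).sub_const k).div
          (hasDerivAt_id (‖z‖ ^ 2)) (pow_pos hn 2).ne'
      refine this.congr_deriv ?_
      simp only [id, Pi.div_apply]
      field_simp
      ring
    have h2 : HasFDerivAt (fun y : ℂ => inner ℝ y e) (innerSL ℝ e) z := by
      simpa [real_inner_comm] using (innerSL ℝ e).hasFDerivAt (x := z)
    have h3 : HasFDerivAt (fun y : ℂ => (c * ((1 + ‖y‖ ^ 2) / (1 - ‖y‖ ^ 2)) - k) *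
        inner ℝ y e / ‖y‖ ^ 2) _ z :=
      ((h1.comp_hasFDerivAt z (hasFDerivAt_norm_sq z)).mul h2).congr_of_eventuallyEq
        (Eventually.of_forall fun y => by simp only [Pi.mul_apply, Function.comp_apply]; ring)
    rw [h3.fderiv]
    simp
    field_simp
    ring
  rw [meanCurvatureOp_eq _ hz, (hflux 1).fderiv_eq, (hflux Complex.I).fderiv_eq, hder, hder,
    invFactorSq]
  have hsq : ‖z‖ ^ 2 = z.re ^ 2 + z.im ^ 2 := by
    rw [← Complex.normSq_eq_norm_sq, Complex.normSq_apply]; ring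
  simp only [Complex.inner]
  simp
  have h4 : ‖z‖ ^ 4 = (‖z‖ ^ 2) ^ 2 := by ring
  have hr : z.re ^ 2 = ‖z‖ ^ 2 - z.im ^ 2 := by linarith
  rw [h4, hr]
  field_simp
  ring

/-! ### The rotational barriers -/

/-- The flux `sinh ρ · w' / √(1 + w'²)` at distance `ρ` of the rotational solution of `Q w = c`
that becomes vertical, descending outwards, at distance `a`. -/
def barrierFlux (c a ρ : ℝ) : ℝ := c * Real.cosh ρ - (c * Real.cosh a + Real.sinh a)

/-- The slope of the rotational solution with flux `barrierFlux c a`. -/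
def barrierSlope (c a ρ : ℝ) : ℝ :=
  barrierFlux c a ρ / √(Real.sinh ρ ^ 2 - barrierFlux c a ρ ^ 2)

/-- `cosh - sinh` is the decreasing function `exp (-ρ)`. -/
lemma cosh_sub_cosh_le {a ρ : ℝ} (h : a ≤ ρ) :
    Real.cosh ρ - Real.cosh a ≤ Real.sinh ρ - Real.sinh a := by
  have h1 := Real.cosh_sub_sinh ρ
  have h2 := Real.cosh_sub_sinh a
  have : Real.exp (-ρ) ≤ Real.exp (-a) := Real.exp_le_exp.2 (by linarith)
  linarith

lemma abs_mul_cosh_sub_cosh_le {c a ρ : ℝ} (ha : 0 ≤ a) (h : a ≤ ρ) :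
    |c * (Real.cosh ρ - Real.cosh a)| ≤ |c| * (Real.sinh ρ - Real.sinh a) := by
  have h1 : Real.cosh a ≤ Real.cosh ρ := by
    rw [Real.cosh_le_cosh, abs_of_nonneg ha, abs_of_nonneg (ha.trans h)]; exact h
  rw [abs_mul, abs_of_nonneg (sub_nonneg.2 h1)]
  exact mul_le_mul_of_nonneg_left (cosh_sub_cosh_le h) (abs_nonneg c)

lemma sub_le_sinh_sub_sinh {a ρ : ℝ} (h : a ≤ ρ) : ρ - a ≤ Real.sinh ρ - Real.sinh a := by
  have := Real.sinh_sub_id_strictMono.monotone h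
  linarith

/-- Of the two factors of `sinh² - flux²`, this one vanishes at `ρ = a` but grows at least linearly;
the other stays at least `2 sinh a`. This produces the inverse square root singularity of the slope.
-/
lemma le_sinh_add_barrierFlux {c a ρ : ℝ} (hc : |c| < 1) (ha : 0 ≤ a) (h : a ≤ ρ) :
    (1 - |c|) * (ρ - a) ≤ Real.sinh ρ + barrierFlux c a ρ := by
  have h1 := (abs_le.1 (abs_mul_cosh_sub_cosh_le (c := c) ha h)).1
  have h2 := mul_le_mul_of_nonneg_left (sub_le_sinh_sub_sinh h) (sub_nonneg.2 hc.le)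
  unfold barrierFlux
  linarith

lemma le_sinh_sub_barrierFlux {c a ρ : ℝ} (hc : |c| < 1) (ha : 0 ≤ a) (h : a ≤ ρ) :
    2 * Real.sinh a ≤ Real.sinh ρ - barrierFlux c a ρ := by
  have h1 := (abs_le.1 (abs_mul_cosh_sub_cosh_le (c := c) ha h)).2
  have h2 := mul_nonneg (sub_nonneg.2 hc.le) ((sub_nonneg.2 h).trans (sub_le_sinh_sub_sinh h))
  unfold barrierFlux
  linarith

lemma abs_barrierFlux_le {c a ρ : ℝ} (hc : |c| < 1) (ha : 0 ≤ a) (h : a ≤ ρ) :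
    |barrierFlux c a ρ| ≤ Real.sinh ρ := by
  have h1 := le_sinh_add_barrierFlux hc ha h
  have h2 := le_sinh_sub_barrierFlux hc ha h
  have h3 := mul_nonneg (sub_nonneg.2 hc.le) (sub_nonneg.2 h)
  have h4 := Real.sinh_nonneg_iff.2 ha
  exact abs_le.2 ⟨by linarith, by linarith⟩

lemma abs_barrierFlux_lt {c a ρ : ℝ} (hc : |c| < 1) (ha : 0 < a) (h : a < ρ) :
    |barrierFlux c a ρ| < Real.sinh ρ := by
  have h1 := le_sinh_add_barrierFlux hc ha.le h.le
  have h2 := le_sinh_sub_barrierFlux hc ha.le h.le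
  have h3 := mul_pos (sub_pos.2 hc) (sub_pos.2 h)
  have h4 := Real.sinh_pos_iff.2 ha
  exact abs_lt.2 ⟨by linarith, by linarith⟩

lemma le_sinh_sq_sub_barrierFlux_sq {c a ρ : ℝ} (hc : |c| < 1) (ha : 0 ≤ a) (h : a ≤ ρ) :
    2 * Real.sinh a * (1 - |c|) * (ρ - a) ≤ Real.sinh ρ ^ 2 - barrierFlux c a ρ ^ 2 := by
  have h1 := le_sinh_add_barrierFlux hc ha h
  have h2 := le_sinh_sub_barrierFlux hc ha h
  have h3 := mul_nonneg (sub_nonneg.2 hc.le) (sub_nonneg.2 h)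
  have h4 := Real.sinh_nonneg_iff.2 ha
  nlinarith [mul_le_mul h2 h1 h3 (by linarith)]

lemma sinh_sq_sub_barrierFlux_sq_pos {c a ρ : ℝ} (hc : |c| < 1) (ha : 0 < a) (h : a < ρ) :
    0 < Real.sinh ρ ^ 2 - barrierFlux c a ρ ^ 2 := by
  refine lt_of_lt_of_le ?_ (le_sinh_sq_sub_barrierFlux_sq hc ha.le h.le)
  have := Real.sinh_pos_iff.2 ha
  have := sub_pos.2 hc
  have := sub_pos.2 h
  positivity

lemma abs_barrierSlope_le {c a b ρ : ℝ} (hc : |c| < 1) (ha : 0 < a) (h : a < ρ) (hb : ρ ≤ b) :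
    |barrierSlope c a ρ| ≤ Real.sinh b / √(2 * Real.sinh a * (1 - |c|) * (ρ - a)) := by
  have h1 := Real.sinh_pos_iff.2 ha
  have h2 := sub_pos.2 hc
  have h3 := sub_pos.2 h
  rw [barrierSlope, abs_div, abs_of_nonneg (Real.sqrt_nonneg _)]
  have h4 := (abs_barrierFlux_le hc ha.le h.le).trans (Real.sinh_le_sinh.2 hb)
  exact div_le_div₀ ((abs_nonneg _).trans h4) h4 (Real.sqrt_pos.2 (by positivity))
    (Real.sqrt_le_sqrt (le_sinh_sq_sub_barrierFlux_sq hc ha.le h.le))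

lemma contDiff_barrierFlux (c a : ℝ) {n : WithTop ℕ∞} : ContDiff ℝ n (barrierFlux c a) :=
  (contDiff_const.mul Real.contDiff_cosh).sub contDiff_const

lemma contDiffOn_barrierSlope {c a : ℝ} (hc : |c| < 1) (ha : 0 < a) {n : WithTop ℕ∞} :
    ContDiffOn ℝ n (barrierSlope c a) (Ioi a) := by
  intro ρ hρ
  have hpos := sinh_sq_sub_barrierFlux_sq_pos hc ha hρ
  have hF : ContDiffAt ℝ n (barrierFlux c a) ρ := (contDiff_barrierFlux c a).contDiffAt
  have h1 : ContDiffAt ℝ n (fun ρ => Real.sinh ρ ^ 2 - barrierFlux c a ρ ^ 2) ρ :=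
    (Real.contDiff_sinh.contDiffAt.pow 2).sub (hF.pow 2)
  exact (hF.div (h1.sqrt hpos.ne') (Real.sqrt_pos.2 hpos).ne').contDiffWithinAt

lemma measurable_barrierSlope (c a : ℝ) : Measurable (barrierSlope c a) := by
  unfold barrierSlope barrierFlux
  fun_prop

lemma intervalIntegrable_barrierSlope {c a b : ℝ} (hc : |c| < 1) (ha : 0 < a) (hab : a ≤ b) :
    IntervalIntegrable (barrierSlope c a) volume a b := by
  have h1 := Real.sinh_pos_iff.2 ha
  have h2 := sub_pos.2 hc
  set K := 2 * Real.sinh a * (1 - |c|) with hK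
  have hbound : IntervalIntegrable
      (fun ρ => Real.sinh b / √K * (ρ - a) ^ (-(1 / 2) : ℝ)) volume a b := by
    have := (intervalIntegral.intervalIntegrable_rpow' (a := 0) (b := b - a)
      (r := -(1 / 2)) (by norm_num)).comp_sub_right a
    simp only [zero_add, sub_add_cancel] at this
    exact this.const_mul _
  refine hbound.mono_fun' (measurable_barrierSlope c a).aestronglyMeasurable ?_
  rw [uIoc_of_le hab]
  refine (ae_restrict_mem measurableSet_Ioc).mono fun ρ hρ => ?_
  have h3 := sub_pos.2 hρ.1
  refine (abs_barrierSlope_le hc ha hρ.1 hρ.2).trans_eq ?_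
  beta_reduce
  rw [← hK, Real.sqrt_mul (by positivity), Real.rpow_neg h3.le, ← Real.sqrt_eq_rpow]
  field_simp

lemma tendsto_barrierSlope_atBot {c a : ℝ} (hc : |c| < 1) (ha : 0 < a) :
    Tendsto (barrierSlope c a) (𝓝[>] a) atBot := by
  have hFc : Continuous (barrierFlux c a) := (contDiff_barrierFlux c a (n := 0)).continuous
  have hFa : barrierFlux c a a = -Real.sinh a := by simp [barrierFlux]
  have hF : Tendsto (barrierFlux c a) (𝓝[>] a) (𝓝 (-Real.sinh a)) := by
    rw [← hFa]; exact hFc.continuousAt.tendsto.mono_left nhdsWithin_le_nhds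
  have hD : Tendsto (fun ρ => √(Real.sinh ρ ^ 2 - barrierFlux c a ρ ^ 2)) (𝓝[>] a) (𝓝[>] 0) := by
    refine tendsto_nhdsWithin_iff.2 ⟨?_, ?_⟩
    · have h : Continuous fun ρ => √(Real.sinh ρ ^ 2 - barrierFlux c a ρ ^ 2) :=
        ((Real.continuous_sinh.pow 2).sub (hFc.pow 2)).sqrt
      have h2 := h.continuousAt.tendsto (x := a)
      simp only [hFa, neg_sq, sub_self, Real.sqrt_zero] at h2
      exact h2.mono_left nhdsWithin_le_nhds
    · filter_upwards [self_mem_nhdsWithin] with ρ hρ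
      exact Real.sqrt_pos.2 (sinh_sq_sub_barrierFlux_sq_pos hc ha hρ)
  have := hF.neg_mul_atTop (neg_neg_of_pos (Real.sinh_pos_iff.2 ha))
    (tendsto_inv_nhdsGT_zero.comp hD)
  exact this.congr fun ρ => by simp [barrierSlope, div_eq_mul_inv]

/-- The barrier that vanishes at distance `b`. -/
def barrier (c a b ρ : ℝ) : ℝ := ∫ r in b..ρ, barrierSlope c a r

lemma hasDerivAt_barrier {c a b ρ : ℝ} (hc : |c| < 1) (ha : 0 < a) (hab : a < b) (hρ : a < ρ) :
    HasDerivAt (barrier c a b) (barrierSlope c a ρ) ρ := by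
  have hcont : ContinuousOn (barrierSlope c a) (Ioi a) :=
    (contDiffOn_barrierSlope hc ha (n := 0)).continuousOn
  refine intervalIntegral.integral_hasDerivAt_right ?_
    (measurable_barrierSlope c a).stronglyMeasurable.stronglyMeasurableAtFilter
    (hcont.continuousAt (Ioi_mem_nhds hρ))
  refine (hcont.mono fun x hx => ?_).intervalIntegrable
  exact (lt_min hab hρ).trans_le hx.1

lemma contDiffOn_barrier {c a b : ℝ} (hc : |c| < 1) (ha : 0 < a) (hab : a < b) :
    ContDiffOn ℝ 2 (barrier c a b) (Ioi a) := by
  rw [show (2 : WithTop ℕ∞) = 1 + 1 by norm_num, contDiffOn_succ_iff_deriv_of_isOpen isOpen_Ioi]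
  refine ⟨fun ρ hρ => (hasDerivAt_barrier hc ha hab hρ).differentiableAt.differentiableWithinAt,
    by simp, ?_⟩
  exact (contDiffOn_barrierSlope hc ha).congr fun ρ hρ => (hasDerivAt_barrier hc ha hab hρ).deriv

lemma continuousOn_barrier {c a b : ℝ} (hc : |c| < 1) (ha : 0 < a) (hab : a ≤ b) :
    ContinuousOn (barrier c a b) (Icc a b) := by
  rw [← uIcc_of_le hab]
  exact intervalIntegral.continuousOn_primitive_interval'
    (intervalIntegrable_barrierSlope hc ha hab) right_mem_uIcc

lemma meanCurvatureOp_barrier {c a b : ℝ} (hc : |c| < 1) (ha : 0 < a) (hab : a < b) {z : ℂ}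
    (hz : ‖z‖ < 1) (haz : a < hypRadius z) :
    meanCurvatureOp (fun y => barrier c a b (hypRadius y)) z = c := by
  refine meanCurvatureOp_radial (k := c * Real.cosh a + Real.sinh a)
    (ne_zero_of_hypRadius_pos (ha.trans haz)) hz ?_
  filter_upwards [lt_mem_nhds haz] with r hr
  exact ⟨abs_barrierFlux_lt hc ha hr, hasDerivAt_barrier hc ha hab hr⟩

/-- Near its vertical boundary circle the barrier descends faster than any linear function. -/
lemma eventually_barrier_le {c a b : ℝ} (hc : |c| < 1) (ha : 0 < a) (hab : a < b) (L : ℝ) :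
    ∀ᶠ ρ in 𝓝[>] a, barrier c a b ρ ≤ barrier c a b a - L * (ρ - a) := by
  have h := (tendsto_barrierSlope_atBot hc ha).eventually (eventually_le_atBot (-L))
  obtain ⟨d, hd, hd2⟩ := mem_nhdsGT_iff_exists_Ioo_subset.1 h
  filter_upwards [Ioo_mem_nhdsGT (lt_min hd hab)] with ρ hρ
  have hρd := hρ.2.trans_le (min_le_left _ _)
  have hρb := hρ.2.trans_le (min_le_right _ _)
  have hint := intervalIntegrable_barrierSlope hc ha hab.le
  have hint1 := intervalIntegrable_barrierSlope hc ha hρ.1.le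
  have hint2 : IntervalIntegrable (barrierSlope c a) volume b ρ := hint.symm.trans hint1
  have hsub : barrier c a b ρ - barrier c a b a = ∫ r in a..ρ, barrierSlope c a r :=
    intervalIntegral.integral_interval_sub_left hint2 hint.symm
  have hle : ∫ r in a..ρ, barrierSlope c a r ≤ ∫ _ in a..ρ, -L :=
    intervalIntegral.integral_mono_on_of_le_Ioo hρ.1.le hint1 intervalIntegrable_const
      fun r hr => hd2 ⟨hr.1, hr.2.trans hρd⟩
  rw [intervalIntegral.integral_const, smul_eq_mul] at hle
  linarith

/-! ### Comparison with the barriers -/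

lemma contDiffAt_of_mem_annulus {a b : ℝ} {u : ℂ → ℝ}
    (hu2 : ContDiffOn ℝ 2 u (interior (hypAnnulus a b))) {z : ℂ}
    (hz : ‖z‖ < 1) (h1 : a < hypRadius z) (h2 : hypRadius z < b) : ContDiffAt ℝ 2 u z :=
  hu2.contDiffAt (isOpen_interior.mem_nhds (hypAnnulus_subset_interior ⟨hz, h1, h2⟩))

lemma hypAnnulus_mono_left {a a' b : ℝ} (h : a ≤ a') : hypAnnulus a' b ⊆ hypAnnulus a b :=
  fun _ hz => ⟨hz.1, h.trans hz.2.1, hz.2.2⟩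

/-- A function that is differentiable at a point of the inner circle cannot touch from below there
a barrier which is vertical on that circle. -/
lemma not_isMaxOn_sub_barrier_of_inner {a b c : ℝ} (hc : |c| < 1) (ha : 0 < a) (hab : a < b)
    {u : ℂ → ℝ} {z : ℂ} (hz : ‖z‖ < 1) (hza : hypRadius z = a) (hu : DifferentiableAt ℝ u z) :
    ¬ IsMaxOn (fun y => u y - barrier c a b (hypRadius y)) (hypAnnulus a b) z := by
  intro hmax
  have hz0 : z ≠ 0 := ne_zero_of_hypRadius_pos (hza ▸ ha)
  have hray : radialPoint z a = z := by rw [← hza]; exact radialPoint_hypRadius hz0 hz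
  have hφ : DifferentiableAt ℝ (u ∘ radialPoint z) a :=
    DifferentiableAt.comp a (by rwa [hray]) (differentiable_radialPoint z a)
  set D := deriv (u ∘ radialPoint z) a
  have hlo := (hasDerivAt_iff_isLittleO.1 hφ.hasDerivAt).bound one_pos
  -- Along the ray `u` falls by at most `(|D| + 1)(r - a)`, while the barrier falls by at least
  -- `(|D| + 2)(r - a)`, so the difference increases strictly.
  obtain ⟨r, ⟨h1, h2⟩, h3⟩ := ((eventually_nhdsWithin_of_eventually_nhds hlo).and
    (eventually_barrier_le hc ha hab (|D| + 2)) |>.and (Ioo_mem_nhdsGT hab)).exists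
  have hr0 : 0 ≤ r := ha.le.trans h3.1.le
  have hrad := hypRadius_radialPoint hz0 hr0
  have hm : u (radialPoint z r) - barrier c a b r ≤ u z - barrier c a b a := by
    have := hmax (show radialPoint z r ∈ hypAnnulus a b from
      ⟨norm_radialPoint_lt_one hz0 hr0, by rw [hrad]; exact h3.1.le, by rw [hrad]; exact h3.2.le⟩)
    simpa [hrad, hza] using this
  have hpos := sub_pos.2 h3.1
  simp only [Function.comp_apply, hray, smul_eq_mul, Real.norm_eq_abs, one_mul,
    abs_of_pos hpos] at h1
  have h4 := (abs_le.1 h1).1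
  have h5 : -|D| * (r - a) ≤ (r - a) * D := by
    rw [mul_comm]; exact mul_le_mul_of_nonneg_left (neg_abs_le D) hpos.le
  nlinarith

/-- A solution of `Q u = c` lies below any barrier of smaller mean curvature defined on a smaller
annulus. -/
lemma le_barrier_add_of_lt {a a' b c c' M : ℝ} (ha : 0 < a) (haa' : a < a') (hab : a' < b)
    (hc' : |c'| < 1) (hcc' : c' < c) {u : ℂ → ℝ}
    (hu2 : ContDiffOn ℝ 2 u (interior (hypAnnulus a b))) (huc : ContinuousOn u (hypAnnulus a b))
    (hQ : ∀ z ∈ interior (hypAnnulus a b), meanCurvatureOp u z = c)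
    (hM : ∀ z ∈ hypCircle b, u z ≤ M) {z : ℂ} (hz : z ∈ hypAnnulus a' b) :
    u z ≤ barrier c' a' b (hypRadius z) + M := by
  have ha' := ha.trans haa'
  have hcont : ContinuousOn (fun y => u y - barrier c' a' b (hypRadius y)) (hypAnnulus a' b) := by
    refine (huc.mono (hypAnnulus_mono_left haa'.le)).sub ?_
    exact (continuousOn_barrier hc' ha' hab.le).comp
      (fun y hy => (continuousAt_hypRadius hy.1).continuousWithinAt) fun y hy => hy.2
  obtain ⟨z₀, hz₀, hmax⟩ := (isCompact_hypAnnulus a' b).exists_isMaxOn ⟨z, hz⟩ hcont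
  suffices h : u z₀ - barrier c' a' b (hypRadius z₀) ≤ M by
    have := (hmax hz).trans h
    linarith
  obtain ⟨hn, hl, hr⟩ := hz₀
  rcases hr.eq_or_lt with hr | hr
  · have := hM z₀ ⟨hn, hr⟩
    simpa [hr, barrier] using this
  -- Because `a < a'`, this holds even when `z₀` lies on the barrier's inner circle.
  have hu : ContDiffAt ℝ 2 u z₀ := contDiffAt_of_mem_annulus hu2 hn (haa'.trans_le hl) hr
  rcases hl.eq_or_lt with hl | hl
  · exact absurd hmax (not_isMaxOn_sub_barrier_of_inner hc' ha' hab hn hl.symm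
      (hu.differentiableAt (by simp)))
  have hw : ContDiffAt ℝ 2 (fun y => barrier c' a' b (hypRadius y)) z₀ :=
    ((contDiffOn_barrier hc' ha' hab).contDiffAt (Ioi_mem_nhds hl)).comp z₀
      (contDiffAt_hypRadius (ne_zero_of_hypRadius_pos (ha'.trans hl)) hn)
  have hloc : IsLocalMax (u - fun y => barrier c' a' b (hypRadius y)) z₀ :=
    hmax.isLocalMax (mem_interior_iff_mem_nhds.1 (hypAnnulus_subset_interior ⟨hn, hl, hr⟩))
  have := meanCurvatureOp_le_of_isLocalMax_sub hn hu hw hloc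
  rw [meanCurvatureOp_barrier hc' ha' hab hn hl,
    hQ z₀ (hypAnnulus_subset_interior ⟨hn, haa'.trans hl, hr⟩)] at this
  linarith

/-- For fixed `ρ > a` the integration range stays away from the singularity. For small `ε` at least
half of `1 - |c|` and half of `ρ - a` survive, so a constant dominates the slopes. -/
lemma tendsto_barrier {a b c ρ : ℝ} (hc : |c| < 1) (ha : 0 < a) (haρ : a < ρ) (hρb : ρ ≤ b) :
    Tendsto (fun ε => barrier (c - ε) (a + ε) b ρ) (𝓝[>] 0) (𝓝 (barrier c a b ρ)) := by
  have hsa := Real.sinh_pos_iff.2 ha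
  have hk : 0 < 1 - |c| := sub_pos.2 hc
  have hd : 0 < ρ - a := sub_pos.2 haρ
  have e1 : ∀ᶠ ε : ℝ in 𝓝[>] 0, 0 < ε := self_mem_nhdsWithin
  have e2 : ∀ᶠ ε : ℝ in 𝓝[>] 0, ε < (ρ - a) / 2 :=
    eventually_nhdsWithin_of_eventually_nhds (gt_mem_nhds (by linarith))
  have e3 : ∀ᶠ ε : ℝ in 𝓝[>] 0, ε < (1 - |c|) / 2 :=
    eventually_nhdsWithin_of_eventually_nhds (gt_mem_nhds (by linarith))
  unfold barrier
  refine intervalIntegral.tendsto_integral_filter_of_dominated_convergence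
    (fun _ => Real.sinh b / √(2 * Real.sinh a * ((1 - |c|) / 2) * ((ρ - a) / 2)))
    (Eventually.of_forall fun ε => (measurable_barrierSlope _ _).aestronglyMeasurable) ?_
    intervalIntegrable_const ?_
  · filter_upwards [e1, e2, e3] with ε h1 h2 h3
    refine Eventually.of_forall fun t ht => ?_
    rw [uIoc_of_ge hρb] at ht
    have h4 : |c - ε| ≤ |c| + ε := by
      have := abs_sub c ε; rwa [abs_of_pos h1] at this
    have hsinh : Real.sinh a ≤ Real.sinh (a + ε) := Real.sinh_le_sinh.2 (by linarith)
    refine (abs_barrierSlope_le (by linarith) (by linarith) (by linarith [ht.1]) ht.2).trans ?_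
    have hb0 : 0 ≤ Real.sinh b := Real.sinh_nonneg_iff.2 (by linarith)
    refine div_le_div_of_nonneg_left hb0 (Real.sqrt_pos.2 (by positivity)) (Real.sqrt_le_sqrt ?_)
    refine mul_le_mul (mul_le_mul (by linarith) (by linarith) (by linarith) (by linarith))
      (by linarith [ht.1]) (by linarith) ?_
    exact mul_nonneg (by linarith) (by linarith)
  · refine Eventually.of_forall fun t ht => ?_
    rw [uIoc_of_ge hρb] at ht
    have hpos := sinh_sq_sub_barrierFlux_sq_pos hc ha (haρ.trans ht.1)
    have hF : Continuous fun ε => barrierFlux (c - ε) (a + ε) t := by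
      unfold barrierFlux; fun_prop
    have hD : Continuous fun ε => √(Real.sinh t ^ 2 - barrierFlux (c - ε) (a + ε) t ^ 2) :=
      (continuous_const.sub (hF.pow 2)).sqrt
    have : ContinuousAt (fun ε => barrierSlope (c - ε) (a + ε) t) 0 :=
      hF.continuousAt.div hD.continuousAt (by simpa using (Real.sqrt_pos.2 hpos).ne')
    simpa using this.tendsto.mono_left nhdsWithin_le_nhds

/-- A solution of `Q u = c` in an annulus lies below the rotational solution which is vertical on
the inner circle and lies above it on the outer circle. -/
theorem le_barrier_add {a b c M : ℝ} (ha : 0 < a) (hab : a < b) (hc : |c| < 1) {u : ℂ → ℝ}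
    (hu2 : ContDiffOn ℝ 2 u (interior (hypAnnulus a b))) (huc : ContinuousOn u (hypAnnulus a b))
    (hQ : ∀ z ∈ interior (hypAnnulus a b), meanCurvatureOp u z = c)
    (hM : ∀ z ∈ hypCircle b, u z ≤ M) {z : ℂ} (hz : z ∈ hypAnnulus a b) :
    u z ≤ barrier c a b (hypRadius z) + M := by
  have key : ∀ y ∈ hypAnnulus a b, a < hypRadius y → u y ≤ barrier c a b (hypRadius y) + M := by
    intro y hy hay
    refine ge_of_tendsto ((tendsto_barrier hc ha hay hy.2.2).add_const M) ?_
    have e1 : ∀ᶠ ε : ℝ in 𝓝[>] 0, 0 < ε := self_mem_nhdsWithin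
    have e2 : ∀ᶠ ε : ℝ in 𝓝[>] 0, ε < hypRadius y - a :=
      eventually_nhdsWithin_of_eventually_nhds (gt_mem_nhds (by linarith))
    have e3 : ∀ᶠ ε : ℝ in 𝓝[>] 0, ε < 1 - |c| :=
      eventually_nhdsWithin_of_eventually_nhds (gt_mem_nhds (by linarith))
    filter_upwards [e1, e2, e3] with ε h1 h2 h3
    have h4 : |c - ε| ≤ |c| + ε := by
      have := abs_sub c ε; rwa [abs_of_pos h1] at this
    exact le_barrier_add_of_lt ha (by linarith) (by linarith [hy.2.2]) (by linarith)
      (by linarith) hu2 huc hQ hM ⟨hy.1, by linarith, hy.2.2⟩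
  rcases hz.2.1.eq_or_lt with hza | hza
  swap
  · exact key z hz hza
  have hz0 : z ≠ 0 := ne_zero_of_hypRadius_pos (hza ▸ ha)
  have hray : radialPoint z a = z := by rw [hza]; exact radialPoint_hypRadius hz0 hz.1
  have hmem : ∀ r ∈ Icc a b, radialPoint z r ∈ hypAnnulus a b := fun r hr => by
    have hr0 := ha.le.trans hr.1
    refine ⟨norm_radialPoint_lt_one hz0 hr0, ?_⟩
    rw [hypRadius_radialPoint hz0 hr0]; exact hr
  -- The inner circle is reached along the ray through `z`, by continuity of both sides.
  have hcl : a ∈ closure (Ioc a b) := by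
    rw [closure_Ioc hab.ne]; exact left_mem_Icc.2 hab.le
  have hucomp : ContinuousOn (u ∘ radialPoint z) (Icc a b) :=
    huc.comp (differentiable_radialPoint z).continuous.continuousOn hmem
  have := ContinuousWithinAt.closure_le hcl
    ((hucomp a (left_mem_Icc.2 hab.le)).mono Ioc_subset_Icc_self)
    (((continuousOn_barrier hc ha hab.le a (left_mem_Icc.2 hab.le)).mono
      Ioc_subset_Icc_self).add_const M) fun r hr => by
      have hr0 := ha.le.trans hr.1.le
      have hrad := hypRadius_radialPoint hz0 hr0
      have := key _ (hmem r (Ioc_subset_Icc_self hr)) (by rw [hrad]; exact hr.1)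
      rwa [hrad] at this
  rw [← hza]
  rwa [Function.comp_apply, hray] at this

/-! ### The parameters of the rotational surfaces -/

/-- Squaring the equation for `cosh a` gives `(1 - 4h²) ((α - 2h cosh a)² - sinh² a) = 0`.
Positivity of `α` makes the squaring reversible. -/
lemma rotRadius_eq_iff {h α a : ℝ} (hh0 : 0 < h) (hh1 : h < 1 / 2) (hα : 0 < α) (ha : 0 < a) :
    rotRadius h α = a ↔
      α = 2 * h * Real.cosh a + Real.sinh a ∨ α = 2 * h * Real.cosh a - Real.sinh a := by
  have hk : 0 < 1 - 4 * h ^ 2 := by nlinarith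
  have hpos : 0 < 1 - 4 * h ^ 2 + α ^ 2 := by positivity
  have hX : 1 ≤ (-2 * α * h + √(1 - 4 * h ^ 2 + α ^ 2)) / (1 - 4 * h ^ 2) := by
    rw [one_le_div hk]
    have : 1 - 4 * h ^ 2 + 2 * α * h ≤ √(1 - 4 * h ^ 2 + α ^ 2) := by
      refine Real.le_sqrt_of_sq_le ?_
      -- The difference of the two sides is exactly `(1 - 4h²)(α - 2h)²`.
      nlinarith [mul_nonneg hk.le (sq_nonneg (α - 2 * h))]
    linarith
  have hcosh := Real.cosh_sq a
  have hcpos := Real.cosh_pos a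
  have h1 : rotRadius h α = a ↔
      (-2 * α * h + √(1 - 4 * h ^ 2 + α ^ 2)) / (1 - 4 * h ^ 2) = Real.cosh a := by
    constructor
    · intro H
      rw [← H, rotRadius, Real.cosh_arcosh hX]
    · intro H
      rw [rotRadius, H, Real.arcosh_cosh ha.le]
  have h2 : (-2 * α * h + √(1 - 4 * h ^ 2 + α ^ 2)) / (1 - 4 * h ^ 2) = Real.cosh a ↔
      √(1 - 4 * h ^ 2 + α ^ 2) = (1 - 4 * h ^ 2) * Real.cosh a + 2 * α * h := by
    rw [div_eq_iff hk.ne']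
    constructor <;> intro H <;> linarith
  rw [h1, h2, Real.sqrt_eq_iff_mul_self_eq hpos.le (by positivity)]
  have h3 : α = 2 * h * Real.cosh a + Real.sinh a ∨ α = 2 * h * Real.cosh a - Real.sinh a ↔
      (α - 2 * h * Real.cosh a - Real.sinh a) * (α - 2 * h * Real.cosh a + Real.sinh a) = 0 := by
    rw [mul_eq_zero]
    constructor <;> rintro (H | H) <;> [left; right; left; right] <;> linarith
  rw [h3]
  constructor
  · intro H
    refine (mul_eq_zero.1 (?_ : (1 - 4 * h ^ 2) * _ = 0)).resolve_left hk.ne'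
    linear_combination H + (1 - 4 * h ^ 2) * hcosh
  · intro H
    linear_combination (1 - 4 * h ^ 2) * H - (1 - 4 * h ^ 2) * hcosh

lemma meanCurvatureOp_neg (u : ℂ → ℝ) {z : ℂ} (hz : ‖z‖ < 1) :
    meanCurvatureOp (-u) z = -meanCurvatureOp u z := by
  have hA : areaDensity (-u) = areaDensity u := by
    funext w; simp [areaDensity, fderiv_neg]
  have hq : ∀ e : ℂ, (fun w => fderiv ℝ (-u) w e / areaDensity (-u) w) =
      -fun w => fderiv ℝ u w e / areaDensity u w := by
    intro e; funext w; simp [hA, fderiv_neg, neg_div]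
  rw [meanCurvatureOp_eq _ hz, meanCurvatureOp_eq _ hz, hq, hq, fderiv_neg, fderiv_neg]
  simp only [neg_apply]
  ring

lemma rotSlope_add_sinh (h a : ℝ) :
    rotSlope h (2 * h * Real.cosh a + Real.sinh a) = barrierSlope (2 * h) a := by
  funext ρ
  simp only [rotSlope, barrierSlope, barrierFlux]
  ring_nf

lemma rotSlope_sub_sinh (h a : ℝ) :
    rotSlope h (2 * h * Real.cosh a - Real.sinh a) = -barrierSlope (-(2 * h)) a := by
  funext ρ
  have : -(2 * h * Real.cosh a - Real.sinh a) + 2 * h * Real.cosh ρ =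
      -barrierFlux (-(2 * h)) a ρ := by unfold barrierFlux; ring
  rw [rotSlope, this, Pi.neg_apply, barrierSlope, neg_sq, neg_div]

lemma rotHeight_sub {h α a b ρ : ℝ} (hr : rotRadius h α = a)
    (hint : IntervalIntegrable (rotSlope h α) volume a b) (hρ : ρ ∈ Icc a b) :
    rotHeight h α ρ - rotHeight h α b = ∫ r in b..ρ, rotSlope h α r := by
  have hab : a ≤ b := hρ.1.trans hρ.2
  rw [rotHeight, rotHeight, hr]
  refine intervalIntegral.integral_interval_sub_left (hint.mono_set ?_) hint
  rw [uIcc_of_le hab, uIcc_of_le hρ.1]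
  exact Icc_subset_Icc_right hρ.2

end

theorem theorem1 (h a b : ℝ) (hh0 : 0 < h) (hh1 : h < 1 / 2) (ha : 0 < a) (hab : a < b)
    (u : ℂ → ℝ) (hu2 : ContDiffOn ℝ 2 u (interior (hypAnnulus a b)))
    (huc : ContinuousOn u (hypAnnulus a b))
    (hQ : ∀ z ∈ interior (hypAnnulus a b), meanCurvatureOp u z = 2 * h) :
    (∃ β M : ℝ,
      (2 * h < β ∧ rotRadius h β = a ∧ ∀ β', 2 * h < β' → rotRadius h β' = a → β' = β) ∧
      IsGreatest (u '' hypCircle b) M ∧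
      IntervalIntegrable (rotSlope h β) volume a b ∧
      ∀ z ∈ hypAnnulus a b, u z ≤ rotHeight h β (hypRadius z) - rotHeight h β b + M) ∧
    (a < Real.arcosh (1 / √(1 - 4 * h ^ 2)) →
      ∃ α m : ℝ,
        (0 < α ∧ α < 2 * h ∧ rotRadius h α = a ∧
          ∀ α', 0 < α' → α' < 2 * h → rotRadius h α' = a → α' = α) ∧
        IsLeast (u '' hypCircle b) m ∧
        IntervalIntegrable (rotSlope h α) volume a b ∧
        ∀ z ∈ hypAnnulus a b, rotHeight h α (hypRadius z) - rotHeight h α b + m ≤ u z) := by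
  have hs : 0 < Real.sinh a := Real.sinh_pos_iff.2 ha
  have hC : 1 < Real.cosh a := Real.one_lt_cosh.2 ha.ne'
  have hCS : Real.cosh a - 1 ≤ Real.sinh a := by
    simpa using cosh_sub_cosh_le ha.le
  -- The two roots lie on opposite sides of `2h`, the lower one because `2h (cosh a - 1) < sinh a`;
  -- this gives uniqueness in each parameter range.
  have hup : 2 * h < 2 * h * Real.cosh a + Real.sinh a := by nlinarith
  have hlow : 2 * h * Real.cosh a - Real.sinh a < 2 * h := by nlinarith
  have hc : |2 * h| < 1 := by rw [abs_of_pos (by linarith)]; linarith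
  have hc' : |-(2 * h)| < 1 := by rwa [abs_neg]
  have hcirc : IsCompact (u '' hypCircle b) := by
    rw [hypCircle_eq]
    exact (isCompact_hypAnnulus b b).image_of_continuousOn
      (huc.mono (hypAnnulus_mono_left hab.le))
  have hne : (u '' hypCircle b).Nonempty := (hypCircle_nonempty (ha.trans hab).le).image u
  constructor
  · obtain ⟨M, hM⟩ := hcirc.exists_isGreatest hne
    have hrad : rotRadius h (2 * h * Real.cosh a + Real.sinh a) = a :=
      (rotRadius_eq_iff hh0 hh1 (by linarith) ha).2 (Or.inl rfl)
    have hint : IntervalIntegrable (rotSlope h (2 * h * Real.cosh a + Real.sinh a)) volume a b := by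
      rw [rotSlope_add_sinh]; exact intervalIntegrable_barrierSlope hc ha hab.le
    refine ⟨_, M, ⟨hup, hrad, fun β' h1 h2 => ?_⟩, hM, hint, fun z hz => ?_⟩
    · exact ((rotRadius_eq_iff hh0 hh1 (by linarith) ha).1 h2).resolve_right
        fun h3 => by linarith
    · rw [rotHeight_sub hrad hint hz.2, rotSlope_add_sinh]
      exact le_barrier_add ha hab hc hu2 huc hQ (fun y hy => hM.2 (mem_image_of_mem u hy)) hz
  · intro ha2
    have hk : 0 < 1 - 4 * h ^ 2 := by nlinarith
    -- The bound on `a` says `(1 - 4h²) cosh² a < 1`, that is, `sinh a < 2h cosh a`.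
    have hα : 0 < 2 * h * Real.cosh a - Real.sinh a := by
      have hsq := Real.sqrt_pos.2 hk
      have h1 : 1 ≤ 1 / √(1 - 4 * h ^ 2) := by
        rw [one_le_div hsq]; exact Real.sqrt_le_iff.2 ⟨zero_le_one, by nlinarith⟩
      have h2 : Real.cosh a < 1 / √(1 - 4 * h ^ 2) := by
        rw [← Real.cosh_arcosh h1, Real.cosh_lt_cosh, abs_of_pos ha,
          abs_of_nonneg (Real.arcosh_nonneg h1)]
        exact ha2
      rw [lt_div_iff₀ hsq] at h2
      have h3 : (Real.cosh a * √(1 - 4 * h ^ 2)) ^ 2 < 1 :=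
        pow_lt_one₀ (by positivity) h2 two_ne_zero
      rw [mul_pow, Real.sq_sqrt hk.le] at h3
      have h4 : Real.sinh a ^ 2 < (2 * h * Real.cosh a) ^ 2 := by
        have := Real.cosh_sq a
        linear_combination h3 - this
      exact sub_pos.2 (lt_of_pow_lt_pow_left₀ 2 (by positivity) h4)
    obtain ⟨m, hm⟩ := hcirc.exists_isLeast hne
    have hrad : rotRadius h (2 * h * Real.cosh a - Real.sinh a) = a :=
      (rotRadius_eq_iff hh0 hh1 hα ha).2 (Or.inr rfl)
    have hint : IntervalIntegrable (rotSlope h (2 * h * Real.cosh a - Real.sinh a)) volume a b := by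
      rw [rotSlope_sub_sinh]; exact (intervalIntegrable_barrierSlope hc' ha hab.le).neg
    refine ⟨_, m, ⟨hα, hlow, hrad, fun α' h0 h1 h2 => ?_⟩, hm, hint, fun z hz => ?_⟩
    · exact ((rotRadius_eq_iff hh0 hh1 h0 ha).1 h2).resolve_left fun h3 => by linarith
    · rw [rotHeight_sub hrad hint hz.2, rotSlope_sub_sinh]
      have := le_barrier_add (u := -u) ha hab hc' hu2.neg huc.neg
        (fun y hy => by rw [meanCurvatureOp_neg u (interior_subset hy).1, hQ y hy])
        (M := -m) (fun y hy => neg_le_neg (hm.2 (mem_image_of_mem u hy))) hz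
      simp only [Pi.neg_apply, intervalIntegral.integral_neg, barrier] at this ⊢
      linarith
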